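/- Let $m\ge 1$ and let $\mathcal S_m$ be the symmetric group on $\{1,\dots,m\}$. A permutation $\pi\in\mathcal S_m$ is an involution if $\pi=\pi^{-1}$, it is centrosymmetric if $\pi(i)+\pi(m+1-i)=m+1$ for all $1\le i\le m$, and it avoids $321$ if there are no $i<j<k$ with $\pi(i)>\pi(j)>\pi(k)$. Let $\mathcal I^C_m(321)$ be the set of $321$-avoiding centrosymmetric involutions in $\mathcal S_m$. Put $\mathrm{Des}(\pi)=\{i: 1\le i<m,\ \pi(i)>\pi(i+1)\}$ and $\mathrm{Des}^+(\pi)=\mathrm{Des}(\pi)\cap\{1,\dots,\lfloor m/2\rfloor\}$, and let $\mathrm{des}(\pi)=|\mathrm{Des}(\pi)|$, $\mathrm{des}^+(\pi)=|\mathrm{Des}^+(\pi)|$ and $\mathrm{maj}^+(\pi)=\sum_{i\in \mathrm{Des}^+(\pi)} i$. Let $\binom{n}{k}_q$ denote the $q$-binomial coefficient. **Proposition.** For every integer $n\ge 0$, the following identities of polynomials in $q$ hold: $$\sum_{\pi\in \mathcal I^C_{2n+1}(321)}q^{\mathrm{des}^+(\pi)}=\sum_{k=0}^{\lfloor n/2\rfloor}\binom{\lceil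 n/2\rceil}{k}\binom{\lfloor n/2\rfloor}{k}q^k,$$ $$\sum_{\pi\in \mathcal I^C_{2n+1}(321)}q^{\mathrm{maj}^+(\pi)}=\binom{n}{\lfloor n/2\rfloor}_q,$$ $$\sum_{\pi\in \mathcal I^C_{2n+1}(321)}q^{\mathrm{des}(\pi)}=\sum_{k=0}^{\lfloor n/2\rfloor}\binom{\lceil n/2\rceil}{k}\binom{\lfloor n/2\rfloor}{k}q^{2k}.$$ -/

import Mathlib

namespace CentroInv

open Polynomial

/-! Permutations of `{1, …, m}` are `Equiv.Perm (Fin m)`: the element `i : Fin m` stands for the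
number `i.val + 1`. -/

/-- `π` contains the pattern `τ`: some subsequence `π(i₁) … π(i_k)` with `i₁ < ⋯ < i_k` has its
entries in the same relative order as `τ(1) … τ(k)`. -/
def ContainsPattern {m k : ℕ} (π : Equiv.Perm (Fin m)) (τ : Equiv.Perm (Fin k)) : Prop :=
  ∃ f : Fin k → Fin m, StrictMono f ∧ ∀ a b : Fin k, π (f a) < π (f b) ↔ τ a < τ b

/-- `π` avoids the pattern `τ`. -/
def Avoids {m k : ℕ} (π : Equiv.Perm (Fin m)) (τ : Equiv.Perm (Fin k)) : Prop :=
  ¬ ContainsPattern π τ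

/-- The pattern `321`, that is, the permutation `1 ↦ 3, 2 ↦ 2, 3 ↦ 1`. -/
def pattern321 : Equiv.Perm (Fin 3) := Fin.revPerm

/-- `π` is centrosymmetric: `π(i) + π(m + 1 - i) = m + 1` for all `1 ≤ i ≤ m`
(`i.rev` stands for the number `m + 1 - i`). -/
def IsCentrosymmetric {m : ℕ} (π : Equiv.Perm (Fin m)) : Prop :=
  ∀ i : Fin m, ((π i).val + 1) + ((π i.rev).val + 1) = m + 1

open Classical in
/-- The finite set of `321`-avoiding centrosymmetric involutions of `{1, …, m}`. -/
noncomputable def avoidingCentroInvolutions (m : ℕ) : Finset (Equiv.Perm (Fin m)) :=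
  Finset.univ.filter fun π => π⁻¹ = π ∧ IsCentrosymmetric π ∧ Avoids π pattern321

/-- The set of descent positions: the `i` with `1 ≤ i < m` and `π(i) > π(i + 1)`. -/
def Des {m : ℕ} (π : Equiv.Perm (Fin m)) : Finset ℕ :=
  (Finset.univ.filter fun j : Fin m =>
    ∃ k : Fin m, k.val = j.val + 1 ∧ π k < π j).image fun j => j.val + 1

/-- The number of descents. -/
def des {m : ℕ} (π : Equiv.Perm (Fin m)) : ℕ := (Des π).card

/-- The set of descent positions in `{1, …, ⌊m/2⌋}`. -/
def DesPlus {m : ℕ} (π : Equiv.Perm (Fin m)) : Finset ℕ := Des π ∩ Finset.Icc 1 (m / 2)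

/-- The number of descents in the first half. -/
def desPlus {m : ℕ} (π : Equiv.Perm (Fin m)) : ℕ := (DesPlus π).card

/-- The sum of the descent positions in the first half. -/
def majPlus {m : ℕ} (π : Equiv.Perm (Fin m)) : ℕ := ∑ i ∈ DesPlus π, i

/-- The `q`-factorial `[n]_q! = ∏_{j=1}^n (1 + q + ⋯ + q^(j-1))`, with `q = X`. -/
noncomputable def qFactorial (n : ℕ) : ℤ[X] :=
  ∏ j ∈ Finset.range n, ∑ i ∈ Finset.range (j + 1), X ^ i

/-- The `q`-binomial coefficient, with `q = X`, by the `q`-Pascal recursion. It is the quotient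
`[n]_q! / ([k]_q! [n-k]_q!)` for `k ≤ n`, see `qBinomial_mul_qFactorial`, and `0` for `k > n`. -/
noncomputable def qBinomial : ℕ → ℕ → ℤ[X]
  | _, 0 => 1
  | 0, _ + 1 => 0
  | n + 1, k + 1 => qBinomial n k + X ^ (k + 1) * qBinomial n (k + 1)

theorem qBinomial_eq_zero_of_lt (n k : ℕ) (h : n < k) : qBinomial n k = 0 := by
  induction n generalizing k with
  | zero => obtain ⟨k, rfl⟩ : ∃ j, k = j + 1 := ⟨k - 1, by omega⟩; simp [qBinomial]
  | succ n ih =>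
    obtain ⟨k, rfl⟩ : ∃ j, k = j + 1 := ⟨k - 1, by omega⟩
    simp [qBinomial, ih k (by omega), ih (k + 1) (by omega)]

/-- The defining property of the `q`-binomial coefficient as a quotient of `q`-factorials. -/
theorem qBinomial_mul_qFactorial (n k : ℕ) (h : k ≤ n) :
    qBinomial n k * (qFactorial k * qFactorial (n - k)) = qFactorial n := by
  induction n generalizing k with
  | zero =>
    obtain rfl : k = 0 := by omega
    simp [qBinomial, qFactorial]
  | succ n ih =>
    cases k with
    | zero => simp [qBinomial, qFactorial]
    | succ k =>
      have hs : ∀ j, qFactorial (j + 1) =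
          qFactorial j * ∑ i ∈ Finset.range (j + 1), (X : ℤ[X]) ^ i := fun j => by
        simp only [qFactorial, Finset.prod_range_succ]
      have h1 := ih k (by omega)
      rcases Nat.lt_or_ge n (k + 1) with hlt | hge
      · obtain rfl : n = k := by omega
        have hz := qBinomial_eq_zero_of_lt n (n + 1) (by omega)
        simp only [Nat.sub_self] at h1 ⊢
        rw [qBinomial, hz, hs]
        linear_combination (∑ i ∈ Finset.range (n + 1), (X : ℤ[X]) ^ i) * h1
      · obtain ⟨l, rfl⟩ : ∃ l, n = k + 1 + l := ⟨n - (k + 1), by omega⟩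
        have h2 := ih (k + 1) (by omega)
        rw [show k + 1 + l - k = l + 1 by omega] at h1
        rw [show k + 1 + l - (k + 1) = l by omega] at h2
        rw [show k + 1 + l + 1 - (k + 1) = l + 1 by omega]
        have hsum : (∑ i ∈ Finset.range (k + 1 + l + 1), (X : ℤ[X]) ^ i) =
            (∑ i ∈ Finset.range (k + 1), (X : ℤ[X]) ^ i) +
              X ^ (k + 1) * ∑ i ∈ Finset.range (l + 1), (X : ℤ[X]) ^ i := by
          rw [show k + 1 + l + 1 = (k + 1) + (l + 1) by omega, Finset.sum_range_add,
            Finset.mul_sum]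
          simp only [pow_add]
        rw [qBinomial, hs (k + 1 + l), hsum, hs k, hs l]
        rw [hs l] at h1
        rw [hs k] at h2
        linear_combination (∑ i ∈ Finset.range (k + 1), (X : ℤ[X]) ^ i) * h1 +
          (X ^ (k + 1) * ∑ i ∈ Finset.range (l + 1), (X : ℤ[X]) ^ i) * h2

/-- Avoidance of `321` in terms of triples of positions. -/
theorem avoids_pattern321_iff {m : ℕ} (π : Equiv.Perm (Fin m)) :
    Avoids π pattern321 ↔
      ∀ i j k : Fin m, i < j → j < k → ¬ (π k < π j ∧ π j < π i) := by
  constructor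
  · rintro h i j k hij hjk ⟨h1, h2⟩
    refine h ⟨![i, j, k], ?_, ?_⟩
    · intro a b hab
      fin_cases a <;> fin_cases b <;> simp_all [hij.trans hjk]
    · intro a b
      have h3 := h1.trans h2
      fin_cases a <;> fin_cases b <;>
        simp [pattern321, h1, h2, h3, h1.le, h2.le, h3.le, Fin.ext_iff]
  · rintro h ⟨f, hf, hπ⟩
    exact h (f 0) (f 1) (f 2) (hf (by decide)) (hf (by decide))
      ⟨(hπ 2 1).2 (by decide), (hπ 1 0).2 (by decide)⟩

end CentroInv

namespace CentroInv

open Polynomial Finset Function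

/-! A centrosymmetric permutation of odd degree fixes the middle point, and if it also avoids 321 no
entry crosses the middle: `i < n` sent beyond `n` would form a 321 with the middle and the mirror
image of `i`. So `π` amounts to an arbitrary 321-avoiding involution of the first `n` points
(`natFun_lt_middle`, `leftHalf_injOn`, `exists_leftHalf_eq`).

Recording excedances, fixed points and anti-excedances as steps `1`, `0`, `-1` turns such an
involution into a nonnegative path of length `n` that ends at height `0` and is flat only on the
axis. The path determines the involution (`eq_of_signWord`) and every such path occurs
(`exists_signWord_eq`). Descents are exactly the peaks (`descent_iff`, `DesPlus_eq_peaks`), so each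
generating function is a sum over paths of a product of weights `w i` over the peak positions `i`
(`sum_prod_DesPlus`).

Removing the last step gives a recursion in length and final height (`pathSum_add_two`). It is the
recursion of the sum `T a b` over all words with `a` up and `b` down steps, unconstrained and
weighted by peaks; the flat steps on the axis play the role of a reflection, through the symmetry of
`T` (`pathSum_eq_of_rec`). It remains to check that the proposed closed forms satisfy the recursion
of `T` for `w i = q` and `w i = q ^ i`. The third identity follows from the first, since descents
come in mirror pairs. -/

/-! ### Words and lattice paths. -/

/-- Height of the lattice path with steps `s` after `m` steps. -/
def height (s : ℕ → ℤ) (m : ℕ) : ℤ := ∑ j ∈ range m, s j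

/-- The first `n` steps stay weakly above the axis and have their flat steps on the axis. -/
def IsPath (s : ℕ → ℤ) (n : ℕ) : Prop :=
  (∀ m ≤ n, 0 ≤ height s m) ∧ ∀ m < n, s m = 0 → height s m = 0

open Classical in
/-- Sequences with entries in `{1, 0, -1}` that vanish from `n` on. -/
noncomputable def words : ℕ → Finset (ℕ → ℤ)
  | 0 => {fun _ => 0}
  | n + 1 => (words n ×ˢ ({1, 0, -1} : Finset ℤ)).image fun p => update p.1 n p.2

theorem mem_words {n : ℕ} {s : ℕ → ℤ} :
    s ∈ words n ↔ (∀ i, s i = 1 ∨ s i = 0 ∨ s i = -1) ∧ ∀ i, n ≤ i → s i = 0 := by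
  induction n generalizing s with
  | zero =>
    simp only [words, mem_singleton]
    constructor
    · rintro rfl; simp
    · rintro ⟨-, h⟩; funext i; exact h i (Nat.zero_le i)
  | succ n ih =>
    simp only [words, mem_image, mem_product, Prod.exists, ih]
    constructor
    · rintro ⟨t, x, ⟨⟨h1, h2⟩, hx⟩, rfl⟩
      refine ⟨fun i => ?_, fun i hi => ?_⟩
      · rcases eq_or_ne i n with rfl | h
        · simpa using hx
        · simpa [h] using h1 i
      · rw [update_of_ne (by omega)]; exact h2 i (by omega)
    · rintro ⟨h1, h2⟩
      refine ⟨update s n 0, s n, ⟨⟨fun i => ?_, fun i hi => ?_⟩, ?_⟩, by simp⟩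
      · rcases eq_or_ne i n with rfl | h
        · simp
        · simpa [h] using h1 i
      · rcases eq_or_ne i n with rfl | h
        · simp
        · simpa [h] using h2 i (by omega)
      · simpa using h1 n

theorem sum_words_succ {R : Type*} [AddCommMonoid R] (n : ℕ) (F : (ℕ → ℤ) → R) :
    ∑ s ∈ words (n + 1), F s =
      ∑ s ∈ words n, (F (update s n 1) + (F (update s n 0) + F (update s n (-1)))) := by
  classical
  rw [words, sum_image, sum_product]
  · refine sum_congr rfl fun s _ => ?_
    simp
  · rintro ⟨s, x⟩ h ⟨t, y⟩ h' e
    simp only [coe_product, Set.mem_prod, mem_coe, mem_words] at h h'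
    simp only at e
    -- The words of length `n` vanish at coordinate `n`, so that coordinate of the update recovers
    -- the appended letter.
    have e1 := congrFun e n
    simp only [update_self] at e1
    subst e1
    refine Prod.ext (funext fun i => ?_) rfl
    rcases eq_or_ne i n with rfl | hi
    · simp [h.1.2 i le_rfl, h'.1.2 i le_rfl]
    · simpa [hi] using congrFun e i

theorem height_succ (s : ℕ → ℤ) (n : ℕ) : height s (n + 1) = height s n + s n := by
  simp [height, sum_range_succ]

theorem height_update (s : ℕ → ℤ) (n : ℕ) (x : ℤ) {m : ℕ} (h : m ≤ n) :
    height (update s n x) m = height s m := by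
  refine sum_congr rfl fun i hi => ?_
  rw [mem_range] at hi
  rw [update_of_ne (by omega)]

theorem isPath_succ {s : ℕ → ℤ} {n : ℕ} :
    IsPath s (n + 1) ↔ IsPath s n ∧ 0 ≤ height s n + s n ∧ (s n = 0 → height s n = 0) := by
  rw [← height_succ]
  constructor
  · rintro ⟨h1, h2⟩
    exact ⟨⟨fun m hm => h1 m (by omega), fun m hm => h2 m (by omega)⟩, h1 _ le_rfl,
      h2 _ (Nat.lt_succ_self n)⟩
  · rintro ⟨⟨h1, h2⟩, h3, h4⟩
    refine ⟨fun m hm => ?_, fun m hm => ?_⟩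
    · rcases Nat.lt_or_ge n m with h | h
      · obtain rfl : m = n + 1 := by omega
        exact h3
      · exact h1 m h
    · rcases Nat.lt_or_ge m n with h | h
      · exact h2 m h
      · obtain rfl : m = n := by omega
        exact h4

theorem isPath_update (s : ℕ → ℤ) (n : ℕ) (x : ℤ) : IsPath (update s n x) n ↔ IsPath s n := by
  unfold IsPath
  refine and_congr (forall₂_congr fun m hm => by rw [height_update s n x hm])
    (forall₂_congr fun m hm => ?_)
  rw [height_update s n x hm.le, update_of_ne hm.ne]

theorem isPath_update_succ {s : ℕ → ℤ} {n : ℕ} {x : ℤ} :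
    IsPath (update s n x) (n + 1) ↔
      IsPath s n ∧ 0 ≤ height s n + x ∧ (x = 0 → height s n = 0) := by
  rw [isPath_succ, isPath_update, height_update s n x le_rfl, update_self]

theorem height_update_succ (s : ℕ → ℤ) (n : ℕ) (x : ℤ) :
    height (update s n x) (n + 1) = height s n + x := by
  rw [height_succ, height_update s n x le_rfl, update_self]

theorem IsPath.height_nonneg {s : ℕ → ℤ} {n : ℕ} (h : IsPath s n) : 0 ≤ height s n :=
  h.1 n le_rfl

/-! ### Paths weighted by their peaks. -/

section Weighted

variable {R : Type*} [CommRing R] (w : ℕ → R)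

/-- The positions `i + 1` of the peaks among the first `n` steps. -/
def peaks (s : ℕ → ℤ) (n : ℕ) : Finset ℕ :=
  ((range n).filter fun i => s i = 1 ∧ s (i + 1) = -1).image (· + 1)

/-- The product of the weights of the peaks. -/
noncomputable def peakWeight (s : ℕ → ℤ) (n : ℕ) : R := ∏ i ∈ peaks s n, w i

theorem peakWeight_eq (s : ℕ → ℤ) (n : ℕ) :
    peakWeight w s n = ∏ i ∈ range n, if s i = 1 ∧ s (i + 1) = -1 then w (i + 1) else 1 := by
  rw [peakWeight, peaks, prod_image (by intro a _ b _ h; simpa using h), prod_filter]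

/-- Only a down step can complete a peak; a final up step is followed by the default value `0`. -/
theorem peakWeight_update_succ {s : ℕ → ℤ} {n : ℕ} (hs : s ∈ words n) {x : ℤ} (hx : x ≠ -1) :
    peakWeight w (update s n x) (n + 1) = peakWeight w s n := by
  rw [mem_words] at hs
  rw [peakWeight_eq, peakWeight_eq, prod_range_succ]
  rw [if_neg (fun h => by
    rw [update_of_ne (show n + 1 ≠ n by omega), hs.2 _ (Nat.le_succ n)] at h; simp at h), mul_one]
  refine prod_congr rfl fun i hi => ?_
  rw [mem_range] at hi
  rw [update_of_ne (by omega)]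
  rcases eq_or_ne (i + 1) n with h | h
  · rw [h, update_self, hs.2 n le_rfl]; simp [hx]
  · rw [update_of_ne h]

/-- A down step completes a peak exactly after an up step. Writing the new factor as `1 + (w (n + 1)
- 1)` isolates the correction that needs the previous step. -/
theorem peakWeight_update_neg_one {s : ℕ → ℤ} {n : ℕ} (hs : s ∈ words (n + 1)) :
    peakWeight w (update s (n + 1) (-1)) (n + 2) =
      peakWeight w s (n + 1) + if s n = 1 then (w (n + 1) - 1) * peakWeight w s (n + 1) else 0 := by
  rw [mem_words] at hs
  have hc : ∏ i ∈ range n, (if update s (n + 1) (-1) i = 1 ∧ update s (n + 1) (-1) (i + 1) = -1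
        then w (i + 1) else 1) =
      ∏ i ∈ range n, if s i = 1 ∧ s (i + 1) = -1 then w (i + 1) else 1 := by
    refine prod_congr rfl fun i hi => ?_
    rw [mem_range] at hi
    rw [update_of_ne (by omega), update_of_ne (by omega)]
  rw [peakWeight_eq, peakWeight_eq, prod_range_succ, prod_range_succ, prod_range_succ, hc,
    update_self, update_of_ne (by omega), update_of_ne (by omega), hs.2 (n + 1) le_rfl]
  by_cases h : s n = 1
  · simp only [h, true_and, if_true]; norm_num; ring
  · simp [h]

open Classical in
/-- Weighted count of the paths of length `n` that end at height `h`. -/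
noncomputable def pathSum (n : ℕ) (h : ℤ) : R :=
  ∑ s ∈ words n, if IsPath s n ∧ height s n = h then peakWeight w s n else 0

open Classical in
/-- Weighted count of the paths of length `n + 1` that end at height `h` with an up step. -/
noncomputable def pathSumUp (n : ℕ) (h : ℤ) : R :=
  ∑ s ∈ words (n + 1),
    if (IsPath s (n + 1) ∧ height s (n + 1) = h) ∧ s n = 1 then peakWeight w s (n + 1) else 0

theorem pathSum_zero (h : ℤ) : pathSum w 0 h = if h = 0 then 1 else 0 := by
  simp [pathSum, words, IsPath, height, peakWeight, peaks, eq_comm]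

theorem pathSum_of_neg (n : ℕ) {h : ℤ} (hh : h < 0) : pathSum w n h = 0 := by
  refine sum_eq_zero fun s _ => if_neg ?_
  rintro ⟨h1, rfl⟩
  exact absurd h1.height_nonneg (not_le.2 hh)

/-- Deleting the final up step is a weight-preserving bijection. -/
theorem pathSumUp_eq (n : ℕ) (h : ℤ) : pathSumUp w n (h + 1) = pathSum w n h := by
  classical
  rw [pathSumUp, sum_words_succ, pathSum]
  refine sum_congr rfl fun s hs => ?_
  rw [isPath_update_succ, isPath_update_succ, isPath_update_succ]
  simp only [update_self, height_update_succ]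
  rw [peakWeight_update_succ w hs (by norm_num)]
  have : (((IsPath s n ∧ 0 ≤ height s n + 1 ∧ ((1 : ℤ) = 0 → height s n = 0)) ∧
      height s n + 1 = h + 1) ∧ True) ↔ IsPath s n ∧ height s n = h := by
    constructor
    · rintro ⟨⟨⟨h1, -⟩, h2⟩, -⟩; exact ⟨h1, by omega⟩
    · rintro ⟨h1, h2⟩
      have := h1.height_nonneg
      exact ⟨⟨⟨h1, by omega, by omega⟩, by omega⟩, trivial⟩
  rw [if_congr this rfl rfl]
  norm_num

theorem pathSum_one (h : ℤ) :
    pathSum w 1 h = (if h = 1 then 1 else 0) + if h = 0 then 1 else 0 := by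
  classical
  have hu : update (fun _ : ℕ => (0 : ℤ)) 0 0 = fun _ => 0 := by simp
  rw [pathSum, sum_words_succ]
  simp only [isPath_update_succ, height_update_succ]
  simp [words, IsPath, height, peakWeight_eq, eq_comm]

/-- The summands correspond to the last step: up, flat (possible only on the axis), down. The
correction for a last down step runs over paths whose previous step is up, and deleting both steps
returns to height `h`. -/
theorem pathSum_add_two (n : ℕ) {h : ℤ} (hh : 0 ≤ h) :
    pathSum w (n + 2) h = pathSum w (n + 1) (h - 1) +
      ((if h = 0 then pathSum w (n + 1) 0 else 0) +
        (pathSum w (n + 1) (h + 1) + (w (n + 1) - 1) * pathSum w n h)) := by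
  classical
  rw [pathSum, sum_words_succ, sum_add_distrib, sum_add_distrib]
  congr 1
  · rw [pathSum]
    refine sum_congr rfl fun s hs => ?_
    simp only [isPath_update_succ, height_update_succ]
    rw [peakWeight_update_succ w hs (by norm_num)]
    refine if_congr ?_ rfl rfl
    constructor
    · rintro ⟨⟨h1, -⟩, h2⟩; exact ⟨h1, by omega⟩
    · rintro ⟨h1, h2⟩; exact ⟨⟨h1, by omega, by omega⟩, by omega⟩
  congr 1
  · split_ifs with h0
    · subst h0
      rw [pathSum]
      refine sum_congr rfl fun s hs => ?_
      simp only [isPath_update_succ, height_update_succ]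
      rw [peakWeight_update_succ w hs (by norm_num)]
      refine if_congr ?_ rfl rfl
      constructor
      · rintro ⟨⟨h1, -⟩, h2⟩; exact ⟨h1, by omega⟩
      · rintro ⟨h1, h2⟩; exact ⟨⟨h1, by omega, by omega⟩, by omega⟩
    · refine sum_eq_zero fun s _ => if_neg ?_
      simp only [isPath_update_succ, height_update_succ]
      rintro ⟨⟨-, -, h1⟩, h2⟩
      have := h1 trivial
      omega
  · rw [← pathSumUp_eq w n h, pathSum, pathSumUp, mul_sum, ← sum_add_distrib]
    refine sum_congr rfl fun s hs => ?_
    simp only [isPath_update_succ, height_update_succ]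
    rw [peakWeight_update_neg_one w hs]
    have : ((IsPath s (n + 1) ∧ 0 ≤ height s (n + 1) + -1 ∧
        ((-1 : ℤ) = 0 → height s (n + 1) = 0)) ∧ height s (n + 1) + -1 = h) ↔
        IsPath s (n + 1) ∧ height s (n + 1) = h + 1 := by
      constructor
      · rintro ⟨⟨h1, -⟩, h2⟩; exact ⟨h1, by omega⟩
      · rintro ⟨h1, h2⟩; exact ⟨⟨h1, by omega, by omega⟩, by omega⟩
    simp only [this]
    by_cases h1 : IsPath s (n + 1) ∧ height s (n + 1) = h + 1 <;> by_cases h2 : s n = 1 <;>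
      simp [h1, h2]

theorem pathSum_of_lt (n : ℕ) {h : ℤ} (hh : n < h) : pathSum w n h = 0 := by
  induction n using Nat.strong_induction_on generalizing h with
  | _ n ih =>
    match n with
    | 0 => rw [pathSum_zero, if_neg (by omega)]
    | 1 => rw [pathSum_one, if_neg (by push_cast at hh; omega), if_neg (by omega), add_zero]
    | n + 2 =>
      push_cast at hh
      rw [pathSum_add_two w n (by omega), ih (n + 1) (by omega) (by push_cast; omega),
        if_neg (by omega), ih (n + 1) (by omega) (by push_cast; omega), ih n (by omega) (by omega)]
      simp

variable {w} {T : ℕ → ℕ → R}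

/-- The weight depends only on `a + b`, so the recursion and its boundary values are symmetric. -/
theorem symm_of_rec (h0 : ∀ b, T 0 b = 1) (h1 : ∀ a, T a 0 = 1)
    (h2 : ∀ a b, T (a + 1) (b + 1) = T a (b + 1) + T (a + 1) b + (w (a + b + 1) - 1) * T a b)
    (a b : ℕ) : T a b = T b a := by
  induction a generalizing b with
  | zero => rw [h0, h1]
  | succ a iha =>
    induction b with
    | zero => rw [h0, h1]
    | succ b ihb =>
      rw [h2, h2, ihb, iha (b + 1), iha b, add_comm b a]
      ring

/-- The parity of `n - h` decides between `a - b = h` and `a - b = h + 1`. Away from the axis the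
two recursions agree term by term. -/
theorem pathSum_eq_of_rec (h0 : ∀ b, T 0 b = 1) (h1 : ∀ a, T a 0 = 1)
    (h2 : ∀ a b, T (a + 1) (b + 1) = T a (b + 1) + T (a + 1) b + (w (a + b + 1) - 1) * T a b)
    (n h a b : ℕ) (hn : a + b = n) (hab : a = b + h ∨ a = b + h + 1) :
    pathSum w n h = T a b := by
  induction n using Nat.strong_induction_on generalizing h a b with
  | _ n ih =>
    match n with
    | 0 =>
      obtain ⟨rfl, rfl⟩ : a = 0 ∧ b = 0 := by omega
      obtain rfl : h = 0 := by omega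
      simp [pathSum_zero, h0]
    | 1 =>
      obtain ⟨rfl, rfl⟩ : a = 1 ∧ b = 0 := by omega
      obtain rfl | rfl : h = 0 ∨ h = 1 := by omega
      all_goals simp [pathSum_one, h1]
    | n + 2 =>
      rw [pathSum_add_two w n (by omega)]
      obtain ⟨a, rfl⟩ : ∃ c, a = c + 1 := ⟨a - 1, by omega⟩
      cases b with
      | zero =>
        rw [pathSum_of_lt w (n + 1) (h := (h : ℤ) + 1) (by push_cast; omega), if_neg (by omega)]
        rw [pathSum_of_lt w n (by omega), h1]
        have e1 := ih (n + 1) (by omega) (h - 1) (n + 1) 0 (by omega) (by omega)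
        rw [Nat.cast_sub (by omega), Nat.cast_one, h1] at e1
        rw [e1]
        ring
      | succ b =>
        rw [h2, ih n (by omega) h a b (by omega) (by omega)]
        have e1 := ih (n + 1) (by omega) (h + 1) (a + 1) b (by omega) (by omega)
        rw [Nat.cast_add, Nat.cast_one] at e1
        rw [e1, show a + b + 1 = n + 1 by omega]
        rcases Nat.eq_zero_or_pos h with rfl | hpos
        · have e2 : pathSum w (n + 1) (0 : ℕ) = T a (b + 1) := by
            rcases hab with hab | hab
            · rw [symm_of_rec h0 h1 h2]
              exact ih (n + 1) (by omega) 0 (b + 1) a (by omega) (by omega)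
            · exact ih (n + 1) (by omega) 0 a (b + 1) (by omega) (by omega)
          rw [Nat.cast_zero] at e2
          rw [pathSum_of_neg w _ (by simp), Nat.cast_zero, if_pos rfl, e2]
          ring
        · have e2 := ih (n + 1) (by omega) (h - 1) a (b + 1) (by omega) (by omega)
          rw [Nat.cast_sub (by omega), Nat.cast_one] at e2
          rw [if_neg (by omega), e2]
          ring

end Weighted

/-! ### Involutions avoiding 321 and their sign words. -/

/-- Involutions of `ℕ` without a decreasing subsequence of length three. -/
structure IsAvoidingInvolution (g : ℕ → ℕ) : Prop where
  invol : ∀ i, g (g i) = i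
  avoids : ∀ i j k, i < j → j < k → ¬ (g k < g j ∧ g j < g i)

/-- The word that records excedances by `1`, fixed points by `0`, and anti-excedances by `-1`. -/
def signWord (g : ℕ → ℕ) (i : ℕ) : ℤ := Int.sign ((g i : ℤ) - i)

theorem signWord_eq_one {g : ℕ → ℕ} {i : ℕ} : signWord g i = 1 ↔ i < g i := by
  rw [signWord, Int.sign_eq_one_iff_pos]; omega

theorem signWord_eq_neg_one {g : ℕ → ℕ} {i : ℕ} : signWord g i = -1 ↔ g i < i := by
  rw [signWord, Int.sign_eq_neg_one_iff_neg]; omega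

theorem signWord_eq_zero {g : ℕ → ℕ} {i : ℕ} : signWord g i = 0 ↔ g i = i := by
  rw [signWord, Int.sign_eq_zero_iff_zero]; omega

theorem signWord_mem (g : ℕ → ℕ) (i : ℕ) :
    signWord g i = 1 ∨ signWord g i = 0 ∨ signWord g i = -1 := by
  rw [signWord_eq_one, signWord_eq_zero, signWord_eq_neg_one]; omega

namespace IsAvoidingInvolution

variable {g g' : ℕ → ℕ}

/-- Both involutions have an anti-excedance at `g i`. The position of `g'` paired with it cannot lie
before `i` by agreement, nor equal `i`, and beyond `i` it is the middle of a 321. -/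
theorem not_lt_of_agree (hg : IsAvoidingInvolution g) (hg' : IsAvoidingInvolution g')
    (h : signWord g = signWord g') {i : ℕ} (ih : ∀ j < i, g j = g' j) (hi : i < g i) :
    ¬ g i < g' i := by
  intro hlt
  have hb : g (g i) < g i := by rw [hg.invol]; exact hi
  have hb' : g' (g i) < g i := by
    rw [← signWord_eq_neg_one] at hb ⊢
    rw [← h]; exact hb
  have ha : g' (g' (g i)) = g i := hg'.invol _
  rcases lt_trichotomy (g' (g i)) i with h1 | h1 | h1
  · have h2 := ih _ h1
    rw [ha] at h2
    have h3 := congrArg g h2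
    rw [hg.invol, hg.invol] at h3
    omega
  · rw [h1] at ha; omega
  · exact hg'.avoids i (g' (g i)) (g i) h1 hb' ⟨by omega, by omega⟩

theorem eq_of_signWord (hg : IsAvoidingInvolution g) (hg' : IsAvoidingInvolution g')
    (h : signWord g = signWord g') : g = g' := by
  funext i
  induction i using Nat.strong_induction_on with
  | _ i ih =>
    rcases lt_trichotomy (g i) i with h1 | h1 | h1
    · have h2 := ih _ h1
      rw [hg.invol] at h2
      have h3 := congrArg g' h2
      rw [hg'.invol] at h3
      exact h3.symm
    · have h2 := h1
      rw [← signWord_eq_zero, h, signWord_eq_zero] at h2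
      rw [h1, h2]
    · have h2 := h1
      rw [← signWord_eq_one, h, signWord_eq_one] at h2
      exact le_antisymm
        (not_lt.1 (hg'.not_lt_of_agree hg h.symm (fun j hj => (ih j hj).symm) h2))
        (not_lt.1 (hg.not_lt_of_agree hg' h ih h1))

end IsAvoidingInvolution

theorem height_eq_card_sub {s : ℕ → ℤ} (hs : ∀ i, s i = 1 ∨ s i = 0 ∨ s i = -1) (m : ℕ) :
    height s m = (#{i ∈ range m | s i = 1} : ℤ) - #{i ∈ range m | s i = -1} := by
  rw [card_filter, card_filter, height]
  push_cast
  rw [← sum_sub_distrib]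
  refine sum_congr rfl fun i _ => ?_
  rcases hs i with h | h | h <;> simp [h]

theorem height_eq_of_le {s : ℕ → ℤ} {n : ℕ} (hs : s ∈ words n) {m : ℕ} (hm : n ≤ m) :
    height s m = height s n := by
  induction m, hm using Nat.le_induction with
  | base => rfl
  | succ m hm ih => rw [height_succ, ih, (mem_words.1 hs).2 m hm, add_zero]

theorem exists_strictMono_pairing {O D : Finset ℕ} (h : #O = #D) :
    ∃ f f' : ℕ → ℕ, (∀ i ∈ O, f i ∈ D ∧ f' (f i) = i) ∧ (∀ i ∈ D, f' i ∈ O ∧ f (f' i) = i) ∧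
      ∀ i ∈ O, ∀ j ∈ O, i < j → f i < f j := by
  let e : O ≃o D := (O.orderIsoOfFin rfl).symm.trans (D.orderIsoOfFin h.symm)
  refine ⟨fun i => if hi : i ∈ O then e ⟨i, hi⟩ else 0,
    fun i => if hi : i ∈ D then e.symm ⟨i, hi⟩ else 0, fun i hi => ?_, fun i hi => ?_,
    fun i hi j hj hij => ?_⟩
  · simp [hi]
  · simp [hi]
  · simp only [hi, hj, dif_pos]
    exact e.strictMono (show (⟨i, hi⟩ : O) < ⟨j, hj⟩ from hij)

/-- The order-preserving pairing of openers `O` with closers `D` works: excedance values increase,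
anti-excedance values increase, and `hflat` keeps fixed points from lying under an arc. -/
theorem exists_involution {O D : Finset ℕ} (hOD : Disjoint O D) (hc : #O = #D)
    (hle : ∀ m, #{i ∈ D | i < m} ≤ #{i ∈ O | i < m})
    (hflat : ∀ m, m ∉ O → m ∉ D → #{i ∈ D | i < m} = #{i ∈ O | i < m}) :
    ∃ g, IsAvoidingInvolution g ∧ (∀ i, i < g i ↔ i ∈ O) ∧ ∀ i, g i < i ↔ i ∈ D := by
  obtain ⟨f, f', hf, hf', hmono⟩ := exists_strictMono_pairing hc
  have hmono' : ∀ i ∈ D, ∀ j ∈ D, i < j → f' i < f' j := by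
    intro i hi j hj hij
    by_contra hcon
    rcases eq_or_lt_of_le (not_lt.1 hcon) with h | h
    · have := congrArg f h
      rw [(hf' i hi).2, (hf' j hj).2] at this
      omega
    · have := hmono _ (hf' j hj).1 _ (hf' i hi).1 h
      rw [(hf' i hi).2, (hf' j hj).2] at this
      omega
  have hnot : ∀ i ∈ O, i ∉ D := fun i hi hi' => disjoint_left.1 hOD hi hi'
  have hlt : ∀ i ∈ O, i < f i := by
    intro i hi
    by_contra hcon
    -- If `f i ≤ i`, the openers up to `i` all have partners up to `f i`, while `i` itself is not an
    -- opener up to `f i`: the prefix ending at `f i` has too many closers.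
    have h1 : #{j ∈ O | j < i + 1} ≤ #{j ∈ D | j < f i + 1} := by
      refine card_le_card_of_injOn f ?_ ?_
      · intro j hj
        simp only [coe_filter, Set.mem_ofPred_eq] at hj ⊢
        refine ⟨(hf j hj.1).1, ?_⟩
        rcases eq_or_lt_of_le (Nat.lt_succ_iff.1 hj.2) with rfl | h
        · omega
        · have := hmono j hj.1 i hi h
          omega
      · intro j hj k hk hjk
        simp only [coe_filter, Set.mem_ofPred_eq] at hj hk
        rw [← (hf j hj.1).2, hjk, (hf k hk.1).2]
    have h2 : f i ≠ i := fun h => hnot i hi (h ▸ (hf i hi).1)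
    have h3 : #{j ∈ O | j < f i + 1} < #{j ∈ O | j < i + 1} := by
      refine card_lt_card ⟨fun j hj => ?_, fun hs => ?_⟩
      · simp only [mem_filter] at hj ⊢
        exact ⟨hj.1, by omega⟩
      · have := hs (mem_filter.2 ⟨hi, Nat.lt_succ_self i⟩)
        simp only [mem_filter] at this
        omega
    have := hle (f i + 1)
    omega
  have hlt' : ∀ i ∈ D, f' i < i := fun i hi => by
    have := hlt _ (hf' i hi).1
    rwa [(hf' i hi).2] at this
  have hunder : ∀ i ∈ O, ∀ j, i < j → j < f i → j ∈ O ∨ j ∈ D := by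
    intro i hi j hij hji
    by_contra hcon
    rw [not_or] at hcon
    have h1 := hflat j hcon.1 hcon.2
    -- The closers before `j` have their partners before `j`, and none of these is `i`, whose arc is
    -- still open. So strictly more openers than closers precede `j`.
    have h2 : #{k ∈ D | k < j} ≤ #(({k ∈ O | k < j} : Finset ℕ).erase i) := by
      refine card_le_card_of_injOn f' ?_ ?_
      · intro k hk
        simp only [coe_filter, Set.mem_ofPred_eq] at hk
        simp only [coe_erase, coe_filter, Set.mem_sdiff, Set.mem_ofPred_eq, Set.mem_singleton_iff]
        have := hlt' k hk.1
        refine ⟨⟨(hf' k hk.1).1, by omega⟩, fun h => ?_⟩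
        have h4 := (hf' k hk.1).2
        rw [h] at h4
        omega
      · intro k hk l hl hkl
        simp only [coe_filter, Set.mem_ofPred_eq] at hk hl
        rw [← (hf' k hk.1).2, hkl, (hf' l hl.1).2]
    rw [card_erase_of_mem (mem_filter.2 ⟨hi, hij⟩)] at h2
    have : 0 < #{k ∈ O | k < j} := card_pos.2 ⟨i, mem_filter.2 ⟨hi, hij⟩⟩
    omega
  obtain ⟨g, hg⟩ : ∃ g : ℕ → ℕ, g = fun i => if i ∈ O then f i else if i ∈ D then f' i else i :=
    ⟨_, rfl⟩
  have gO : ∀ i ∈ O, g i = f i := fun i hi => by simp [hg, hi]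
  have gD : ∀ i ∈ D, g i = f' i := fun i hi => by
    simp [hg, hi, show i ∉ O from fun h => hnot i h hi]
  have gF : ∀ i, i ∉ O → i ∉ D → g i = i := fun i h1 h2 => by simp [hg, h1, h2]
  have hup : ∀ i, i < g i → i ∈ O := by
    intro i h
    by_contra h1
    by_cases h2 : i ∈ D
    · have := hlt' i h2; rw [gD i h2] at h; omega
    · rw [gF i h1 h2] at h; omega
  have hdown : ∀ i, g i < i → i ∈ D := by
    intro i h
    by_contra h1
    by_cases h2 : i ∈ O
    · have := hlt i h2; rw [gO i h2] at h; omega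
    · rw [gF i h2 h1] at h; omega
  refine ⟨g, ⟨fun i => ?_, fun i j k hij hjk => ?_⟩, fun i => ⟨hup i, fun h => ?_⟩,
    fun i => ⟨hdown i, fun h => ?_⟩⟩
  · by_cases h1 : i ∈ O
    · rw [gO i h1, gD _ (hf i h1).1, (hf i h1).2]
    by_cases h2 : i ∈ D
    · rw [gD i h2, gO _ (hf' i h2).1, (hf' i h2).2]
    · rw [gF i h1 h2, gF i h1 h2]
  · rintro ⟨hkj, hji⟩
    rcases lt_trichotomy (g j) j with h | h | h
    · have hj := hdown j h
      have hk := hdown k (by omega)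
      rw [gD j hj, gD k hk] at hkj
      have := hmono' j hj k hk hjk
      omega
    · have hi := hup i (by omega)
      rw [gO i hi] at hji
      rcases hunder i hi j hij (by omega) with h1 | h1
      · have := hlt j h1; rw [gO j h1] at h; omega
      · have := hlt' j h1; rw [gD j h1] at h; omega
    · have hj := hup j h
      have hi := hup i (by omega)
      rw [gO j hj, gO i hi] at hji
      have := hmono i hi j hj hij
      omega
  · rw [gO i h]; exact hlt i h
  · rw [gD i h]; exact hlt' i h

theorem exists_signWord_eq {s : ℕ → ℤ} {n : ℕ} (hs : s ∈ words n) (hp : IsPath s n)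
    (h0 : height s n = 0) : ∃ g, IsAvoidingInvolution g ∧ signWord g = s := by
  have hs' := mem_words.1 hs
  have hlt : ∀ i, s i ≠ 0 → i < n := fun i hi => by
    by_contra h; exact hi (hs'.2 i (not_lt.1 h))
  have hfil : ∀ x : ℤ, x ≠ 0 → ∀ m,
      ({i ∈ ({i ∈ range n | s i = x} : Finset ℕ) | i < m} : Finset ℕ) =
        {i ∈ range m | s i = x} := by
    intro x hx m
    ext i
    simp only [mem_filter, mem_range]
    constructor
    · rintro ⟨⟨-, h⟩, h'⟩; exact ⟨h', h⟩
    · rintro ⟨h', h⟩; exact ⟨⟨hlt i (by rwa [h]), h⟩, h'⟩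
  have hnn : ∀ m, 0 ≤ height s m := by
    intro m
    rcases le_total m n with h | h
    · exact hp.1 m h
    · rw [height_eq_of_le hs h, h0]
  have hz : ∀ m, s m = 0 → height s m = 0 := by
    intro m hm
    rcases Nat.lt_or_ge m n with h | h
    · exact hp.2 m h hm
    · rw [height_eq_of_le hs h, h0]
  simp only [height_eq_card_sub hs'.1] at hnn hz h0
  obtain ⟨g, hg, hO, hD⟩ := exists_involution (O := {i ∈ range n | s i = 1})
    (D := {i ∈ range n | s i = -1})
    (by
      rw [disjoint_left]
      intro i h1 h2
      rw [mem_filter] at h1 h2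
      omega)
    (by omega)
    (fun m => by
      rw [hfil _ (by norm_num), hfil _ (by norm_num)]
      have := hnn m
      omega)
    (fun m h1 h2 => by
      rw [hfil _ (by norm_num), hfil _ (by norm_num)]
      have : s m = 0 := by
        by_contra h
        have h3 := hlt m h
        simp only [mem_filter, mem_range, h3, true_and] at h1 h2
        rcases hs'.1 m with h4 | h4 | h4 <;> contradiction
      have := hz m this
      omega)
  refine ⟨g, hg, funext fun i => ?_⟩
  have hO' : i < g i ↔ s i = 1 := by
    rw [hO, mem_filter, mem_range]
    exact ⟨And.right, fun h => ⟨hlt i (by omega), h⟩⟩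
  have hD' : g i < i ↔ s i = -1 := by
    rw [hD, mem_filter, mem_range]
    exact ⟨And.right, fun h => ⟨hlt i (by omega), h⟩⟩
  rw [← signWord_eq_one] at hO'
  rw [← signWord_eq_neg_one] at hD'
  have := signWord_mem g i
  have := hs'.1 i
  omega

/-- The involution sends each anti-excedance below `m` to an excedance below `m`, so heights are
nonnegative. If `m` is fixed, an arc passing over `m` would make a 321, so all arcs opened before
`m` are closed. -/
theorem IsAvoidingInvolution.isPath {g : ℕ → ℕ} (hg : IsAvoidingInvolution g) (n : ℕ) :
    IsPath (signWord g) n := by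
  have hinj : Injective g := LeftInverse.injective hg.invol
  refine ⟨fun m _ => ?_, fun m _ hm => ?_⟩
  · rw [height_eq_card_sub (signWord_mem g), sub_nonneg, Nat.cast_le]
    refine card_le_card_of_injOn g (fun i hi => ?_) hinj.injOn
    simp only [coe_filter, Set.mem_ofPred_eq, mem_range, signWord_eq_one, signWord_eq_neg_one,
      hg.invol] at hi ⊢
    omega
  · rw [height_eq_card_sub (signWord_mem g), sub_eq_zero, Nat.cast_inj]
    rw [signWord_eq_zero] at hm
    refine card_bij' (fun i _ => g i) (fun i _ => g i) ?_ ?_ (fun i _ => hg.invol i)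
      (fun i _ => hg.invol i)
    · intro i hi
      simp only [mem_filter, mem_range, signWord_eq_one, signWord_eq_neg_one, hg.invol] at hi ⊢
      refine ⟨?_, hi.2⟩
      by_contra hcon
      rcases eq_or_lt_of_le (not_lt.1 hcon) with h | h
      · have := congrArg g h
        rw [hg.invol, hm] at this
        omega
      · exact hg.avoids i m (g i) hi.1 h ⟨by rw [hg.invol]; omega, by omega⟩
    · intro i hi
      simp only [mem_filter, mem_range, signWord_eq_one, signWord_eq_neg_one, hg.invol] at hi ⊢
      omega

theorem IsAvoidingInvolution.height_signWord {g : ℕ → ℕ} (hg : IsAvoidingInvolution g) {n : ℕ}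
    (hn : ∀ i < n, g i < n) : height (signWord g) n = 0 := by
  rw [height_eq_card_sub (signWord_mem g), sub_eq_zero, Nat.cast_inj]
  refine card_bij' (fun i _ => g i) (fun i _ => g i) ?_ ?_ (fun i _ => hg.invol i)
      (fun i _ => hg.invol i)
  all_goals
    intro i hi
    simp only [mem_filter, mem_range, signWord_eq_one, signWord_eq_neg_one, hg.invol] at hi ⊢
    exact ⟨hn i hi.1, hi.2⟩

/-- In a descent of any other type, the partner of one of the two entries completes a 321. -/
theorem IsAvoidingInvolution.descent_iff {g : ℕ → ℕ} (hg : IsAvoidingInvolution g) (j : ℕ) :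
    g (j + 1) < g j ↔ j < g j ∧ g (j + 1) < j + 1 := by
  have hne : ∀ i k, i ≠ k → g i ≠ g k := fun i k h h' =>
    h (LeftInverse.injective hg.invol h')
  constructor
  · intro h
    have i1 := hg.invol j
    have i2 := hg.invol (j + 1)
    constructor
    · by_contra hcon
      rcases eq_or_lt_of_le (not_lt.1 hcon) with h1 | h1
      · exact hg.avoids (g (j + 1)) j (j + 1) (by omega) (by omega) ⟨h, by omega⟩
      · exact hg.avoids (g (j + 1)) (g j) j h h1 ⟨by omega, by omega⟩
    · by_contra hcon
      rcases eq_or_lt_of_le (not_lt.1 hcon) with h1 | h1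
      · exact hg.avoids j (j + 1) (g j) (by omega) (by omega) ⟨by omega, h⟩
      · exact hg.avoids j (j + 1) (g (j + 1)) (by omega) h1 ⟨by omega, h⟩
  · rintro ⟨h1, h2⟩
    have := hne j (j + 1) (by omega)
    omega

/-! ### Reduction of a centrosymmetric involution to its left half. -/

theorem mem_avoidingCentroInvolutions {m : ℕ} {π : Equiv.Perm (Fin m)} :
    π ∈ avoidingCentroInvolutions m ↔ (∀ i, π (π i) = i) ∧ IsCentrosymmetric π ∧
      ∀ i j k : Fin m, i < j → j < k → ¬ (π k < π j ∧ π j < π i) := by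
  classical
  rw [avoidingCentroInvolutions, mem_filter, avoids_pattern321_iff, inv_eq_iff_mul_eq_one,
    Equiv.ext_iff]
  simp

/-- The extension of a permutation of `{0, …, m - 1}` to `ℕ` by the identity. -/
def natFun {m : ℕ} (π : Equiv.Perm (Fin m)) (i : ℕ) : ℕ := if h : i < m then π ⟨i, h⟩ else i

theorem natFun_val {m : ℕ} (π : Equiv.Perm (Fin m)) (i : Fin m) : natFun π i = π i := by
  simp [natFun]

theorem natFun_of_lt {m : ℕ} (π : Equiv.Perm (Fin m)) {i : ℕ} (h : i < m) :
    natFun π i = π ⟨i, h⟩ := dif_pos h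

theorem natFun_of_le {m : ℕ} (π : Equiv.Perm (Fin m)) {i : ℕ} (h : m ≤ i) : natFun π i = i :=
  dif_neg (not_lt.2 h)

theorem natFun_lt {m : ℕ} (π : Equiv.Perm (Fin m)) {i : ℕ} (h : i < m) : natFun π i < m := by
  rw [natFun_of_lt π h]; exact (π ⟨i, h⟩).2

theorem natFun_injective {m : ℕ} : Injective (natFun : Equiv.Perm (Fin m) → ℕ → ℕ) := by
  intro π ρ h
  ext i
  rw [← natFun_val, h, natFun_val]

theorem isAvoidingInvolution_natFun {m : ℕ} {π : Equiv.Perm (Fin m)}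
    (hπ : π ∈ avoidingCentroInvolutions m) : IsAvoidingInvolution (natFun π) := by
  rw [mem_avoidingCentroInvolutions] at hπ
  refine ⟨fun i => ?_, fun i j k hij hjk => ?_⟩
  · rcases Nat.lt_or_ge i m with h | h
    · rw [natFun_of_lt π h, natFun_val, hπ.1]
    · rw [natFun_of_le π h, natFun_of_le π h]
  · rintro ⟨h1, h2⟩
    rcases Nat.lt_or_ge k m with h | h
    · rw [natFun_of_lt π h, natFun_of_lt π (hjk.trans h)] at h1
      rw [natFun_of_lt π (hjk.trans h), natFun_of_lt π ((hij.trans hjk).trans h)] at h2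
      exact hπ.2.2 ⟨i, _⟩ ⟨j, _⟩ ⟨k, h⟩ hij hjk ⟨h1, h2⟩
    · rw [natFun_of_le π h] at h1
      rcases Nat.lt_or_ge j m with h' | h'
      · have := natFun_lt π h'; omega
      · rw [natFun_of_le π h'] at h1; omega

section Odd

variable {n : ℕ} {π : Equiv.Perm (Fin (2 * n + 1))}

theorem natFun_add_natFun (hπ : π ∈ avoidingCentroInvolutions (2 * n + 1)) {i j : ℕ}
    (hij : i + j = 2 * n) : natFun π i + natFun π j = 2 * n := by
  rw [mem_avoidingCentroInvolutions] at hπ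
  have h := hπ.2.1 ⟨i, by omega⟩
  have hr : (⟨i, by omega⟩ : Fin (2 * n + 1)).rev = ⟨j, by omega⟩ := by
    ext; simp only [Fin.val_rev]; omega
  rw [hr] at h
  rw [natFun_of_lt π (show i < 2 * n + 1 by omega), natFun_of_lt π (show j < 2 * n + 1 by omega)]
  omega

theorem natFun_lt_middle (hπ : π ∈ avoidingCentroInvolutions (2 * n + 1)) {i : ℕ} (hi : i < n) :
    natFun π i < n := by
  have hg := isAvoidingInvolution_natFun hπ
  have h1 := natFun_add_natFun hπ (show n + n = 2 * n by omega)
  have h2 := natFun_add_natFun hπ (show i + (2 * n - i) = 2 * n by omega)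
  have h3 : natFun π i ≠ n := fun h => by
    have := congrArg (natFun π) h
    rw [hg.invol] at this
    omega
  by_contra hcon
  -- The value at `i` exceeds `n`, the middle is fixed, and the value at the mirror position is
  -- below `n`.
  exact hg.avoids i n (2 * n - i) hi (by omega) ⟨by omega, by omega⟩

/-- The restriction of `π` to the positions before the middle, extended by the identity. -/
def leftHalf (π : Equiv.Perm (Fin (2 * n + 1))) (i : ℕ) : ℕ := if i < n then natFun π i else i

theorem leftHalf_of_lt {i : ℕ} (h : i < n) : leftHalf π i = natFun π i := if_pos h

theorem leftHalf_of_le {i : ℕ} (h : n ≤ i) : leftHalf π i = i := if_neg (not_lt.2 h)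

theorem isAvoidingInvolution_leftHalf (hπ : π ∈ avoidingCentroInvolutions (2 * n + 1)) :
    IsAvoidingInvolution (leftHalf π) := by
  have hg := isAvoidingInvolution_natFun hπ
  refine ⟨fun i => ?_, fun i j k hij hjk => ?_⟩
  · rcases Nat.lt_or_ge i n with h | h
    · rw [leftHalf_of_lt h, leftHalf_of_lt (natFun_lt_middle hπ h), hg.invol]
    · rw [leftHalf_of_le h, leftHalf_of_le h]
  · rintro ⟨h1, h2⟩
    rcases Nat.lt_or_ge k n with h | h
    · rw [leftHalf_of_lt h, leftHalf_of_lt (hjk.trans h)] at h1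
      rw [leftHalf_of_lt (hjk.trans h), leftHalf_of_lt ((hij.trans hjk).trans h)] at h2
      exact hg.avoids i j k hij hjk ⟨h1, h2⟩
    · rw [leftHalf_of_le h] at h1
      rcases Nat.lt_or_ge j n with h' | h'
      · have := natFun_lt_middle hπ h'; rw [leftHalf_of_lt h'] at h1; omega
      · rw [leftHalf_of_le h'] at h1; omega

theorem leftHalf_injOn {ρ : Equiv.Perm (Fin (2 * n + 1))}
    (hπ : π ∈ avoidingCentroInvolutions (2 * n + 1))
    (hρ : ρ ∈ avoidingCentroInvolutions (2 * n + 1)) (h : leftHalf π = leftHalf ρ) : π = ρ := by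
  have hlow : ∀ i < n, natFun π i = natFun ρ i := fun i hi => by
    rw [← leftHalf_of_lt hi, h, leftHalf_of_lt hi]
  apply natFun_injective
  funext i
  rcases lt_trichotomy i n with hi | rfl | hi
  · exact hlow i hi
  · have h1 := natFun_add_natFun hπ (show i + i = 2 * i by omega)
    have h2 := natFun_add_natFun hρ (show i + i = 2 * i by omega)
    omega
  · rcases Nat.lt_or_ge i (2 * n + 1) with h' | h'
    · have h1 := natFun_add_natFun hπ (show (2 * n - i) + i = 2 * n by omega)
      have h2 := natFun_add_natFun hρ (show (2 * n - i) + i = 2 * n by omega)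
      have h3 := hlow (2 * n - i) (by omega)
      omega
    · rw [natFun_of_le _ h', natFun_of_le _ h']

theorem exists_leftHalf_eq {g : ℕ → ℕ} (hg : IsAvoidingInvolution g) (hn : ∀ i, n ≤ i → g i = i) :
    ∃ π ∈ avoidingCentroInvolutions (2 * n + 1), leftHalf π = g := by
  have hlt : ∀ i < n, g i < n := fun i hi => by
    by_contra h
    have := hn _ (not_lt.1 h)
    rw [hg.invol] at this
    omega
  -- The right half is the left half rotated by 180 degrees. Truncated subtraction gives meaningless
  -- values beyond `2 * n`, where `p` is never used.
  obtain ⟨p, hp⟩ : ∃ p : ℕ → ℕ, p = fun i => if i < n then g i else 2 * n - g (2 * n - i) :=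
    ⟨_, rfl⟩
  have hp1 : ∀ i < n, p i = g i := fun i hi => by simp [hp, hi]
  have hp2 : ∀ i, n ≤ i → p i = 2 * n - g (2 * n - i) := fun i hi => by
    simp [hp, not_lt.2 hi]
  have hmid : p n = n := by
    rw [hp2 n le_rfl, hn _ (by omega)]; omega
  have hhigh : ∀ i, n < i → i ≤ 2 * n → n < p i ∧ p i ≤ 2 * n := fun i h1 h2 => by
    have := hlt (2 * n - i) (by omega)
    rw [hp2 i h1.le]
    omega
  have hsum : ∀ i j, i + j = 2 * n → p i + p j = 2 * n := by
    have key : ∀ i j, i < n → i + j = 2 * n → p i + p j = 2 * n := by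
      intro i j hi hij
      have := hlt i hi
      rw [hp1 i hi, hp2 j (by omega), show 2 * n - j = i by omega]
      omega
    intro i j hij
    rcases lt_trichotomy i n with h | rfl | h
    · exact key i j h hij
    · rw [show j = i by omega, hmid]; omega
    · rw [add_comm]; exact key j i (by omega) (by omega)
  have hpp : ∀ i ≤ 2 * n, p (p i) = i := by
    have key : ∀ i < n, p (p i) = i := fun i hi => by
      rw [hp1 i hi, hp1 _ (hlt i hi), hg.invol]
    intro i hi
    rcases lt_trichotomy i n with h | rfl | h
    · exact key i h
    · rw [hmid, hmid]
    · have h1 := hsum i (2 * n - i) (by omega)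
      have h2 := hsum (p i) (p (2 * n - i)) h1
      have := key (2 * n - i) (by omega)
      omega
  have hple : ∀ i, i < 2 * n + 1 → p i < 2 * n + 1 := fun i hi => by
    have := hsum i (2 * n - i) (by omega)
    omega
  have havoid : ∀ i j k, i < j → j < k → k ≤ 2 * n → ¬ (p k < p j ∧ p j < p i) := by
    rintro i j k hij hjk hk ⟨h1, h2⟩
    -- The halves are preserved, so a 321 lies on the side of its middle entry. On the right,
    -- rotation reverses both positions and values and yields a 321 of `g`.
    rcases lt_trichotomy j n with h | rfl | h
    · have h3 := hlt j h
      rw [← hp1 j h] at h3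
      have h4 : k < n := by
        by_contra hcon
        rcases eq_or_lt_of_le (not_lt.1 hcon) with rfl | h5
        · omega
        · have := hhigh k h5 hk; omega
      rw [hp1 k h4, hp1 j h] at h1
      rw [hp1 j h, hp1 i (by omega)] at h2
      exact hg.avoids i j k hij hjk ⟨h1, h2⟩
    · have := hlt i hij
      rw [hp1 i hij] at h2
      omega
    · have h3 := hhigh j h (by omega)
      have h4 : n < i := by
        by_contra hcon
        rcases eq_or_lt_of_le (not_lt.1 hcon) with rfl | h5
        · omega
        · have := hlt i h5; rw [hp1 i h5] at h2; omega
      have := hlt (2 * n - i) (by omega)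
      have := hlt (2 * n - j) (by omega)
      have := hlt (2 * n - k) (by omega)
      rw [hp2 j (by omega), hp2 k (by omega)] at h1
      rw [hp2 j (by omega), hp2 i (by omega)] at h2
      exact hg.avoids (2 * n - k) (2 * n - j) (2 * n - i) (by omega) (by omega)
        ⟨by omega, by omega⟩
  let f : Fin (2 * n + 1) → Fin (2 * n + 1) := fun i => ⟨p i, hple i i.2⟩
  have hf : Involutive f := fun i => Fin.ext (hpp i (by omega))
  refine ⟨hf.toPerm, ?_, ?_⟩
  · rw [mem_avoidingCentroInvolutions]
    refine ⟨hf, fun i => ?_, fun i j k hij hjk => havoid i j k hij hjk (by omega)⟩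
    have := hsum i i.rev (by rw [Fin.val_rev]; omega)
    change (p i + 1) + (p i.rev + 1) = _
    omega
  · funext i
    rcases Nat.lt_or_ge i n with h | h
    · rw [leftHalf_of_lt h, natFun_of_lt _ (by omega : i < 2 * n + 1)]
      exact hp1 i h
    · rw [leftHalf_of_le h, hn i h]

theorem mem_Des {m a : ℕ} {π : Equiv.Perm (Fin m)} :
    a ∈ Des π ↔ ∃ j, j + 1 = a ∧ a < m ∧ natFun π (j + 1) < natFun π j := by
  simp only [Des, mem_image, mem_filter, mem_univ, true_and]
  constructor
  · rintro ⟨j, ⟨k, hk, h⟩, rfl⟩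
    refine ⟨j, rfl, by omega, ?_⟩
    rw [← hk, natFun_val, natFun_val]
    exact h
  · rintro ⟨j, rfl, hj, h⟩
    rw [natFun_of_lt _ hj, natFun_of_lt _ (by omega : j < m)] at h
    exact ⟨⟨j, by omega⟩, ⟨⟨j + 1, hj⟩, rfl, h⟩, rfl⟩

theorem DesPlus_eq_peaks (hπ : π ∈ avoidingCentroInvolutions (2 * n + 1)) :
    DesPlus π = peaks (signWord (leftHalf π)) n := by
  ext a
  simp only [DesPlus, mem_inter, mem_Des, mem_Icc, peaks, mem_image, mem_filter, mem_range,
    signWord_eq_one, signWord_eq_neg_one]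
  have hmid := natFun_add_natFun hπ (show n + n = 2 * n by omega)
  rw [show (2 * n + 1) / 2 = n by omega]
  have hd := (isAvoidingInvolution_leftHalf hπ).descent_iff
  constructor
  · rintro ⟨⟨j, rfl, -, h⟩, -, hj⟩
    refine ⟨j, ⟨by omega, ?_⟩, rfl⟩
    have h1 := natFun_lt_middle hπ (show j < n by omega)
    -- Position `n`, just before the fixed middle, is an ascent, so it contributes neither a descent
    -- nor a peak.
    have h2 : j + 1 < n := by
      by_contra hcon
      obtain rfl : n = j + 1 := by omega
      omega
    rw [← hd, leftHalf_of_lt h2, leftHalf_of_lt (by omega)]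
    exact h
  · rintro ⟨j, ⟨hj, h⟩, rfl⟩
    have h2 : j + 1 < n := by
      by_contra hcon
      have := leftHalf_of_le (π := π) (not_lt.1 hcon)
      omega
    rw [← hd, leftHalf_of_lt h2, leftHalf_of_lt (by omega)] at h
    exact ⟨⟨j, rfl, by omega, h⟩, by omega, by omega⟩

/-- Rotation maps descent `a` to descent `2 * n + 1 - a`, which exchanges the two halves of the
descent set. -/
theorem des_eq_two_mul_desPlus (hπ : π ∈ avoidingCentroInvolutions (2 * n + 1)) :
    des π = 2 * desPlus π := by
  have hrev : ∀ a ∈ Des π, 2 * n + 1 - a ∈ Des π := by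
    intro a ha
    rw [mem_Des] at ha ⊢
    obtain ⟨j, rfl, hj, h⟩ := ha
    refine ⟨2 * n - (j + 1), by omega, by omega, ?_⟩
    have h1 := natFun_add_natFun hπ (show (2 * n - (j + 1)) + (j + 1) = 2 * n by omega)
    have h2 := natFun_add_natFun hπ (show (2 * n - (j + 1) + 1) + j = 2 * n by omega)
    omega
  have hlt : ∀ a ∈ Des π, 1 ≤ a ∧ a < 2 * n + 1 := by
    intro a ha
    rw [mem_Des] at ha
    obtain ⟨j, rfl, hj, -⟩ := ha
    omega
  have hsdiff : #(Des π \ DesPlus π) = #(DesPlus π) := by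
    refine card_bij' (fun a _ => 2 * n + 1 - a) (fun a _ => 2 * n + 1 - a) ?_ ?_ ?_ ?_
    all_goals
      intro a ha
      simp only [DesPlus, mem_sdiff, mem_inter, mem_Icc, not_and] at ha ⊢
      have := hlt a ha.1
      have := hrev a ha.1
    · have := ha.2 ha.1
      exact ⟨by assumption, by omega⟩
    · exact ⟨by assumption, by omega⟩
    · omega
    · omega
  have := card_sdiff_add_card_eq_card (show DesPlus π ⊆ Des π from inter_subset_left)
  rw [des, desPlus]
  omega

theorem sum_prod_DesPlus {R : Type*} [CommRing R] (w : ℕ → R) (n : ℕ) :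
    ∑ π ∈ avoidingCentroInvolutions (2 * n + 1), ∏ i ∈ DesPlus π, w i = pathSum w n 0 := by
  classical
  rw [pathSum, ← sum_filter]
  refine sum_bij (fun π _ => signWord (leftHalf π)) (fun π hπ => ?_) (fun π hπ ρ hρ h => ?_)
    (fun s hs => ?_) (fun π hπ => ?_)
  · have hg := isAvoidingInvolution_leftHalf hπ
    rw [mem_filter, mem_words]
    refine ⟨⟨signWord_mem _, fun i hi => signWord_eq_zero.2 (leftHalf_of_le hi)⟩, hg.isPath n,
      hg.height_signWord fun i hi => ?_⟩
    rw [leftHalf_of_lt hi]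
    exact natFun_lt_middle hπ hi
  · exact leftHalf_injOn hπ hρ ((isAvoidingInvolution_leftHalf hπ).eq_of_signWord
      (isAvoidingInvolution_leftHalf hρ) h)
  · rw [mem_filter] at hs
    obtain ⟨g, hg, rfl⟩ := exists_signWord_eq hs.1 hs.2.1 hs.2.2
    obtain ⟨π, hπ, rfl⟩ := exists_leftHalf_eq hg
      fun i hi => signWord_eq_zero.1 ((mem_words.1 hs.1).2 i hi)
    exact ⟨π, hπ, rfl⟩
  · rw [DesPlus_eq_peaks hπ, peakWeight]

end Odd

/-! ### Closed forms satisfying the recursion. -/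

theorem sum_prod_DesPlus_eq_of_rec {R : Type*} [CommRing R] {w : ℕ → R} {T : ℕ → ℕ → R}
    (h0 : ∀ b, T 0 b = 1) (h1 : ∀ a, T a 0 = 1)
    (h2 : ∀ a b, T (a + 1) (b + 1) = T a (b + 1) + T (a + 1) b + (w (a + b + 1) - 1) * T a b)
    (n : ℕ) :
    ∑ π ∈ avoidingCentroInvolutions (2 * n + 1), ∏ i ∈ DesPlus π, w i =
      T ((n + 1) / 2) (n / 2) := by
  rw [sum_prod_DesPlus]
  exact_mod_cast pathSum_eq_of_rec h0 h1 h2 n 0 ((n + 1) / 2) (n / 2) (by omega) (by omega)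

/-- The polynomial that counts words with `a` up and `b` down steps by the number of peaks. -/
noncomputable def peakPolynomial (a b : ℕ) : ℤ[X] :=
  ∑ k ∈ range (b + 1), (a.choose k : ℤ[X]) * (b.choose k : ℤ[X]) * X ^ k

/-- The cutoff at `b` is harmless because `b.choose k` vanishes beyond it. -/
theorem coeff_peakPolynomial (a b k : ℕ) :
    (peakPolynomial a b).coeff k = a.choose k * b.choose k := by
  simp only [peakPolynomial, finsetSum_coeff, ← Nat.cast_mul, coeff_natCast_mul, coeff_X_pow]
  rcases Nat.lt_or_ge k (b + 1) with h | h
  · simp [Finset.sum_ite_eq, h]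
  · simp [Finset.sum_ite_eq, not_lt.2 h, Nat.choose_eq_zero_of_lt h]

theorem peakPolynomial_succ_succ (a b : ℕ) :
    peakPolynomial (a + 1) (b + 1) =
      peakPolynomial a (b + 1) + peakPolynomial (a + 1) b + (X - 1) * peakPolynomial a b := by
  ext k
  cases k with
  | zero => simp [sub_mul, coeff_peakPolynomial]
  | succ k =>
    simp only [sub_mul, one_mul, coeff_add, coeff_sub, coeff_X_mul, coeff_peakPolynomial,
      Nat.choose_succ_succ]
    push_cast
    ring

theorem geom_sum_ne_zero (n : ℕ) : (∑ i ∈ range (n + 1), (X : ℤ[X]) ^ i) ≠ 0 := by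
  intro h
  have := congrArg (Polynomial.eval 1) h
  simp only [eval_finsetSum, eval_pow, eval_X, one_pow, sum_const, card_range, eval_zero,
    nsmul_eq_mul, mul_one] at this
  norm_cast at this

theorem qFactorial_ne_zero (n : ℕ) : qFactorial n ≠ 0 :=
  prod_ne_zero_iff.2 fun j _ => geom_sum_ne_zero j

theorem qFactorial_succ (n : ℕ) :
    qFactorial (n + 1) = qFactorial n * ∑ i ∈ range (n + 1), X ^ i := by
  simp only [qFactorial, prod_range_succ]

/-- The absorption identity, obtained by cancelling `q`-factorials in the domain `ℤ[X]`. -/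
theorem one_sub_X_pow_mul_qBinomial (a b : ℕ) :
    (1 - X ^ (b + 1)) * qBinomial (a + b + 1) (b + 1) =
      (1 - X ^ (a + b + 1)) * qBinomial (a + b) b := by
  have h1 := qBinomial_mul_qFactorial (a + b + 1) (b + 1) (by omega)
  have h2 := qBinomial_mul_qFactorial (a + b) b (by omega)
  rw [show a + b + 1 - (b + 1) = a by omega, qFactorial_succ, qFactorial_succ] at h1
  rw [show a + b - b = a by omega] at h2
  have g1 := mul_neg_geom_sum (X : ℤ[X]) (b + 1)
  have g2 := mul_neg_geom_sum (X : ℤ[X]) (a + b + 1)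
  refine mul_right_cancel₀ (mul_ne_zero (qFactorial_ne_zero b) (qFactorial_ne_zero a)) ?_
  rw [← g1, ← g2]
  linear_combination (1 - X) * h1 - (1 - X) * (∑ i ∈ range (a + b + 1), (X : ℤ[X]) ^ i) * h2

theorem qBinomial_zero_right (n : ℕ) : qBinomial n 0 = 1 := by
  cases n <;> simp [qBinomial]

theorem qBinomial_self (n : ℕ) : qBinomial n n = 1 := by
  have h := qBinomial_mul_qFactorial n n le_rfl
  rw [Nat.sub_self, show qFactorial 0 = 1 by simp [qFactorial], mul_one] at h
  exact mul_right_cancel₀ (qFactorial_ne_zero n) (h.trans (one_mul _).symm)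

/-- Compared with the `q`-Pascal rule, the two sides differ exactly by the absorption identity. -/
theorem qBinomial_add_succ_succ (a b : ℕ) :
    qBinomial (a + 1 + (b + 1)) (b + 1) = qBinomial (a + (b + 1)) (b + 1) +
      qBinomial (a + 1 + b) b + (X ^ (a + b + 1) - 1) * qBinomial (a + b) b := by
  have h := one_sub_X_pow_mul_qBinomial a b
  rw [show a + 1 + (b + 1) = a + b + 1 + 1 by omega, qBinomial,
    show a + (b + 1) = a + b + 1 by omega, show a + 1 + b = a + b + 1 by omega]
  linear_combination -h

theorem sum_X_pow_desPlus (n : ℕ) :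
    ∑ π ∈ avoidingCentroInvolutions (2 * n + 1), (X : ℤ[X]) ^ desPlus π =
      peakPolynomial ((n + 1) / 2) (n / 2) := by
  rw [← sum_prod_DesPlus_eq_of_rec (w := fun _ => X) (fun b => ?_) (fun a => ?_)
    peakPolynomial_succ_succ n]
  · simp [desPlus]
  · ext k
    rw [coeff_peakPolynomial, coeff_one]
    cases k <;> simp
  · simp [peakPolynomial]

theorem sum_X_pow_majPlus (n : ℕ) :
    ∑ π ∈ avoidingCentroInvolutions (2 * n + 1), (X : ℤ[X]) ^ majPlus π =
      qBinomial n (n / 2) := by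
  have h := sum_prod_DesPlus_eq_of_rec (w := fun i => (X : ℤ[X]) ^ i)
    (T := fun a b => qBinomial (a + b) b) (fun b => ?_) (fun a => qBinomial_zero_right _)
    qBinomial_add_succ_succ n
  · rw [show (n + 1) / 2 + n / 2 = n by omega] at h
    rw [← h]
    exact sum_congr rfl fun π _ => (prod_pow_eq_pow_sum _ _ _).symm
  · rw [zero_add, qBinomial_self]

/-- As `des` is twice `desPlus`, this is the substitution of `q ^ 2` for `q`. -/
theorem sum_X_pow_des (n : ℕ) :
    ∑ π ∈ avoidingCentroInvolutions (2 * n + 1), (X : ℤ[X]) ^ des π =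
      expand ℤ 2 (peakPolynomial ((n + 1) / 2) (n / 2)) := by
  rw [← sum_X_pow_desPlus, map_sum]
  refine sum_congr rfl fun π hπ => ?_
  rw [des_eq_two_mul_desPlus hπ, map_pow, expand_X, pow_mul]

end CentroInv

theorem proposition3p1 (n : ℕ) :
    (∑ π ∈ CentroInv.avoidingCentroInvolutions (2 * n + 1),
        (Polynomial.X : Polynomial ℤ) ^ CentroInv.desPlus π =
      ∑ k ∈ Finset.range (n / 2 + 1),
        (((n + 1) / 2).choose k : Polynomial ℤ) * ((n / 2).choose k : Polynomial ℤ) *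
          Polynomial.X ^ k) ∧
    (∑ π ∈ CentroInv.avoidingCentroInvolutions (2 * n + 1),
        (Polynomial.X : Polynomial ℤ) ^ CentroInv.majPlus π =
      CentroInv.qBinomial n (n / 2)) ∧
    (∑ π ∈ CentroInv.avoidingCentroInvolutions (2 * n + 1),
        (Polynomial.X : Polynomial ℤ) ^ CentroInv.des π =
      ∑ k ∈ Finset.range (n / 2 + 1),
        (((n + 1) / 2).choose k : Polynomial ℤ) * ((n / 2).choose k : Polynomial ℤ) *
          Polynomial.X ^ (2 * k)) :=
  ⟨CentroInv.sum_X_pow_desPlus n, CentroInv.sum_X_pow_majPlus n, by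
    rw [CentroInv.sum_X_pow_des, CentroInv.peakPolynomial, map_sum]
    simp [pow_mul]⟩
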